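/- Let $(M,g)$ be a compact smooth Riemannian manifold (without boundary) and let $X$ be a Lipschitz vector field on $M$, i.e. the components of $X$ in local coordinates are locally Lipschitz. Let $\mu$ be a (positive) Radon measure on $M$. Let $\mathcal P_1(M)$ be the vector space of pointed $1$-chains, i.e. of finitely supported sections $A=\sum_i (p_i;\alpha_i)$, $\alpha_i\in T_{p_i}M$, of $TM$. For $p\in M$ and $u,\alpha\in T_pM$ put $$\Delta_u(p;\alpha)=(\exp_p u;\alpha_u)-(p;\alpha),$$ where $\alpha_u$ is the parallel transport (for the Levi-Civita connection) of $\alpha$ along the geodesic $t\mapsto \exp_p(tu)$, $0\le t\le 1$. A difference chain $D$ of order at most $1$ is either $(p;\alpha)$, with weight $|D|=\|\alpha\|$, or $\Delta_u(p;\alpha)$, with weight $|D|=\|u\|\,\|\alpha\|$. For $A\in\mathcal P_1(M)$ let $$\|A\|_{B^1}=\inf\Big\{\sum_{i=1}^N |D_i| \;:\; A=\sum_{i=1}^N D_i,\ D_i \text{ difference chains of order at most } 1\Big\},$$ and let $\hat{\mathcal B}_1^1(M)$, the space of differential $1$-chains of order $1$, be the completion of $\mathcal P_1(M)$ in this norm.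 Let $\mathcal B_1^1(M)$ be the space of $1$-forms $\omega$ on $M$, acting on $\mathcal P_1(M)$ by $\omega\big(\sum_i(p_i;\alpha_i)\big)=\sum_i\omega_{p_i}(\alpha_i)$, for which there is a constant $C$ with $|\omega(D)|\le C|D|$ for all difference chains $D$ of order at most $1$. Every $\omega\in\mathcal B_1^1(M)$ extends uniquely to a continuous linear functional on $\hat{\mathcal B}_1^1(M)$, and its value at $\xi$ is called the Harrison integral of $\omega$ over $\xi$, written $\int^{H}_{\xi}\omega$. Then there exists a differential chain $\xi_{X,\mu}\in\hat{\mathcal B}_1^1(M)$ such that, for every $\omega\in\mathcal B_1^1(M)$, the function $\iota_X\omega: p\mapsto\omega_p(X_p)$ is $\mu$-integrable and $$\int^{H}_{\xi_{X,\mu}}\omega=\int_M \iota_X\omega\,d\mu .$$ -/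

import Mathlib

open Set MeasureTheory Bundle
open scoped Manifold ContDiff Topology

noncomputable section

namespace DiffChain

section Geometry

variable {n : ℕ} {M : Type*} [TopologicalSpace M] [ChartedSpace (EuclideanSpace ℝ (Fin n)) M]
  [IsManifold (𝓡 n) ∞ M]

/-- The components of the tangent vector `v` at `q` in the coordinates of the chart at `x₀`
(meaningful when `q` lies in the domain of that chart). -/
def chartComponents (x₀ q : M) (v : TangentSpace (𝓡 n) q) : EuclideanSpace ℝ (Fin n) :=
  (trivializationAt (EuclideanSpace ℝ (Fin n)) (TangentSpace (𝓡 n)) x₀).continuousLinearMapAt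
    ℝ q v

/-- The tangent vector at `q` with components `a` in the coordinates of the chart at `x₀`
(meaningful when `q` lies in the domain of that chart). -/
def ofChartComponents (x₀ q : M) (a : EuclideanSpace ℝ (Fin n)) : TangentSpace (𝓡 n) q :=
  (trivializationAt (EuclideanSpace ℝ (Fin n)) (TangentSpace (𝓡 n)) x₀).symmL ℝ q a

/-- A vector field is Lipschitz if, around every point, its components in local coordinates are
Lipschitz functions of the coordinates. -/
def IsLipschitzVectorField (X : ∀ p : M, TangentSpace (𝓡 n) p) : Prop :=
  ∀ x₀ : M, ∃ K : NNReal, ∃ s ∈ 𝓝 (extChartAt (𝓡 n) x₀ x₀),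
    LipschitzOnWith K
      (fun y => chartComponents x₀ ((extChartAt (𝓡 n) x₀).symm y)
        (X ((extChartAt (𝓡 n) x₀).symm y))) s

variable [RiemannianBundle (fun x : M => TangentSpace (𝓡 n) x)]

/-- The metric tensor in the coordinates of the chart at `x₀`: the number `g_y(a, b)`. -/
def chartMetric (x₀ : M) (y a b : EuclideanSpace ℝ (Fin n)) : ℝ :=
  inner ℝ (ofChartComponents x₀ ((extChartAt (𝓡 n) x₀).symm y) a)
    (ofChartComponents x₀ ((extChartAt (𝓡 n) x₀).symm y) b)

/-- The derivative at `y`, in the direction `c`, of the coefficient `g(a, b)` of the metric. -/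
def chartMetricDeriv (x₀ : M) (y c a b : EuclideanSpace ℝ (Fin n)) : ℝ :=
  fderiv ℝ (fun z => chartMetric x₀ z a b) y c

/-- Christoffel symbols of the first kind of the Levi-Civita connection in the chart at `x₀`:
`g(∇_a b, c)`, where `a, b, c` are coordinate vector fields with constant components. -/
def chartChristoffel (x₀ : M) (y a b c : EuclideanSpace ℝ (Fin n)) : ℝ :=
  (chartMetricDeriv x₀ y a b c + chartMetricDeriv x₀ y b a c - chartMetricDeriv x₀ y c a b) / 2

theorem chartMetric_smul_left (x₀ : M) (y : EuclideanSpace ℝ (Fin n)) (k : ℝ)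
    (a b : EuclideanSpace ℝ (Fin n)) :
    chartMetric x₀ y (k • a) b = k * chartMetric x₀ y a b := by
  simp only [chartMetric, ofChartComponents, map_smul]
  exact real_inner_smul_left _ _ _

theorem chartMetric_smul_right (x₀ : M) (y : EuclideanSpace ℝ (Fin n)) (k : ℝ)
    (a b : EuclideanSpace ℝ (Fin n)) :
    chartMetric x₀ y a (k • b) = k * chartMetric x₀ y a b := by
  simp only [chartMetric, ofChartComponents, map_smul]
  exact real_inner_smul_right _ _ _

theorem chartChristoffel_smul (x₀ : M) (y : EuclideanSpace ℝ (Fin n)) (k : ℝ)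
    (a b c : EuclideanSpace ℝ (Fin n)) :
    chartChristoffel x₀ y a (k • b) c = k * chartChristoffel x₀ y a b c := by
  have key : ∀ f : EuclideanSpace ℝ (Fin n) → ℝ, ∀ d,
      fderiv ℝ (fun z => k * f z) y d = k * fderiv ℝ f y d := by
    intro f d
    have h : (fun z => k * f z) = k • f := rfl
    rw [h, fderiv_const_smul_field]
    rfl
  simp only [chartChristoffel, chartMetricDeriv, chartMetric_smul_left, chartMetric_smul_right,
    key, map_smul, smul_eq_mul]
  ring

/-- The covariant derivative (for the Levi-Civita connection) of the vector field `V` along the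
curve `γ : [0, 1] → M` exists at time `t` and vanishes, where `T t` is the velocity of `γ`. It is
expressed in a chart whose domain contains `γ t`; the condition does not depend on that chart. -/
def CovDerivEqZeroAt (γ : ℝ → M) (T V : ∀ t, TangentSpace (𝓡 n) (γ t)) (t : ℝ) : Prop :=
  ∃ x₀ : M, γ t ∈ (chartAt (EuclideanSpace ℝ (Fin n)) x₀).source ∧
    ∃ W' : EuclideanSpace ℝ (Fin n),
      HasDerivWithinAt (fun s => chartComponents x₀ (γ s) (V s)) W' (Icc 0 1) t ∧
      ∀ c : EuclideanSpace ℝ (Fin n),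
        chartMetric x₀ (extChartAt (𝓡 n) x₀ (γ t)) W' c
          + chartChristoffel x₀ (extChartAt (𝓡 n) x₀ (γ t)) (chartComponents x₀ (γ t) (T t))
              (chartComponents x₀ (γ t) (V t)) c = 0

theorem CovDerivEqZeroAt.const_smul {γ : ℝ → M} {T V : ∀ t, TangentSpace (𝓡 n) (γ t)} {t : ℝ}
    (h : CovDerivEqZeroAt γ T V t) (k : ℝ) :
    CovDerivEqZeroAt γ T (fun s => k • V s) t := by
  obtain ⟨x₀, hx₀, W', hW', heq⟩ := h
  have hlin : ∀ s, chartComponents x₀ (γ s) (k • V s) = k • chartComponents x₀ (γ s) (V s) :=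
    fun s => map_smul _ k (V s)
  refine ⟨x₀, hx₀, k • W', ?_, fun c => ?_⟩
  · simp only [hlin]
    exact hW'.const_smul k
  · rw [hlin, chartMetric_smul_left, chartChristoffel_smul, ← mul_add, heq c, mul_zero]

/-- `T` is the velocity field of the differentiable curve `γ : [0, 1] → M`. -/
def IsVelocityField (γ : ℝ → M) (T : ∀ t, TangentSpace (𝓡 n) (γ t)) : Prop :=
  ∀ t ∈ Icc (0 : ℝ) 1,
    HasMFDerivWithinAt 𝓘(ℝ, ℝ) (𝓡 n) γ (Icc 0 1) t
      ((ContinuousLinearMap.id ℝ ℝ).smulRight (T t))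

/-- `γ : [0, 1] → M` is a geodesic with velocity field `T`. -/
def IsGeodesic (γ : ℝ → M) (T : ∀ t, TangentSpace (𝓡 n) (γ t)) : Prop :=
  IsVelocityField γ T ∧ ∀ t ∈ Icc (0 : ℝ) 1, CovDerivEqZeroAt γ T T t

/-- `V` is a parallel vector field along the curve `γ : [0, 1] → M` with velocity field `T`, so
that `V 1` is the parallel transport of `V 0` along `γ`. -/
def IsParallel (γ : ℝ → M) (T V : ∀ t, TangentSpace (𝓡 n) (γ t)) : Prop :=
  ∀ t ∈ Icc (0 : ℝ) 1, CovDerivEqZeroAt γ T V t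

end Geometry

section Chains

variable (n : ℕ) (M : Type*) [TopologicalSpace M] [ChartedSpace (EuclideanSpace ℝ (Fin n)) M]

/-- The space `𝒫₁(M)` of pointed `1`-chains: finitely supported sections of `TM = Λ¹ TM`. -/
def PointedChain : Type _ := Π₀ p : M, TangentSpace (𝓡 n) p

instance : AddCommGroup (PointedChain n M) :=
  inferInstanceAs (AddCommGroup (Π₀ p : M, TangentSpace (𝓡 n) p))

instance : Module ℝ (PointedChain n M) :=
  inferInstanceAs (Module ℝ (Π₀ p : M, TangentSpace (𝓡 n) p))

variable {n M}

open Classical in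
/-- The `1`-element `(p; α)`. -/
def element (p : M) (α : TangentSpace (𝓡 n) p) : PointedChain n M :=
  DFinsupp.single (β := fun p : M => TangentSpace (𝓡 n) p) p α

theorem element_smul (c : ℝ) (p : M) (α : TangentSpace (𝓡 n) p) :
    element p (c • α) = c • element p α := by
  classical
  exact DFinsupp.single_smul c α

variable [IsManifold (𝓡 n) ∞ M] [RiemannianBundle (fun x : M => TangentSpace (𝓡 n) x)]

/-- `D` is a difference chain `Δ_U^j(p; α)` of order `j ≤ 1`, and `w` is the number
`|Δ_U^j(p; α)|_j`. For `j = 0` these are `(p; α)` and `‖α‖`. For `j = 1` and `U = {u}` they are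
`Δ_u(p; α) = (exp_p u; α_u) - (p; α)` and `‖u‖ ‖α‖`, where `α_u` is the parallel transport of `α`
along the geodesic `γ : [0, 1] → M` with `γ 0 = p`, velocity `u` at time `0`, and `γ 1 = exp_p u`.
On a complete manifold there is exactly one such `γ`, and one parallel field, for given `p, u, α`.
-/
inductive IsDifferenceChain : PointedChain n M → ℝ → Prop
  | order_zero (p : M) (α : TangentSpace (𝓡 n) p) : IsDifferenceChain (element p α) ‖α‖
  | order_one (γ : ℝ → M) (T V : ∀ t, TangentSpace (𝓡 n) (γ t)) (hγ : IsGeodesic γ T)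
      (hV : IsParallel γ T V) :
      IsDifferenceChain (element (γ 1) (V 1) - element (γ 0) (V 0)) (‖T 0‖ * ‖V 0‖)

/-- `A` is a finite sum of difference chains of order at most `1`, with total weight `s`. -/
def HasDecomposition (A : PointedChain n M) (s : ℝ) : Prop :=
  ∃ l : List (PointedChain n M × ℝ), (∀ d ∈ l, IsDifferenceChain d.1 d.2) ∧
    (l.map Prod.fst).sum = A ∧ (l.map Prod.snd).sum = s

/-- The norm `‖A‖_{B¹}` of a pointed `1`-chain: the infimum of the total weights of all ways of
writing `A` as a finite sum of difference chains of order at most `1`. -/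
def bOneNorm (A : PointedChain n M) : ℝ :=
  sInf {s : ℝ | HasDecomposition A s}

theorem IsDifferenceChain.nonneg {D : PointedChain n M} {w : ℝ} (h : IsDifferenceChain D w) :
    0 ≤ w := by
  cases h <;> positivity

theorem IsDifferenceChain.smul {D : PointedChain n M} {w : ℝ} (h : IsDifferenceChain D w)
    (c : ℝ) : IsDifferenceChain (c • D) (|c| * w) := by
  cases h with
  | order_zero p α =>
    rw [← element_smul]
    have := IsDifferenceChain.order_zero p (c • α)
    rwa [norm_smul, Real.norm_eq_abs] at this
  | order_one γ T V hγ hV =>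
    have := IsDifferenceChain.order_one γ T (fun s => c • V s) hγ
      (fun t ht => (hV t ht).const_smul c)
    rw [element_smul, element_smul, ← smul_sub, norm_smul, Real.norm_eq_abs] at this
    rwa [mul_left_comm] at this

theorem HasDecomposition.nonneg {A : PointedChain n M} {s : ℝ} (h : HasDecomposition A s) :
    0 ≤ s := by
  obtain ⟨l, hl, -, rfl⟩ := h
  refine List.sum_nonneg fun x hx => ?_
  obtain ⟨d, hd, rfl⟩ := List.mem_map.1 hx
  exact (hl d hd).nonneg

theorem hasDecomposition_zero : HasDecomposition (0 : PointedChain n M) 0 :=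
  ⟨[], by simp, by simp, by simp⟩

theorem IsDifferenceChain.hasDecomposition {D : PointedChain n M} {w : ℝ}
    (h : IsDifferenceChain D w) : HasDecomposition D w :=
  ⟨[(D, w)], by simpa using h, by simp, by simp⟩

theorem HasDecomposition.add {A B : PointedChain n M} {s t : ℝ} (hA : HasDecomposition A s)
    (hB : HasDecomposition B t) : HasDecomposition (A + B) (s + t) := by
  obtain ⟨l, hl, rfl, rfl⟩ := hA
  obtain ⟨m, hm, rfl, rfl⟩ := hB
  refine ⟨l ++ m, fun d hd => ?_, by simp, by simp⟩
  rcases List.mem_append.1 hd with h | h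
  · exact hl d h
  · exact hm d h

theorem HasDecomposition.smul {A : PointedChain n M} {s : ℝ} (hA : HasDecomposition A s) (c : ℝ) :
    HasDecomposition (c • A) (|c| * s) := by
  obtain ⟨l, hl, rfl, rfl⟩ := hA
  refine ⟨l.map (fun d => (c • d.1, |c| * d.2)), fun d hd => ?_, ?_, ?_⟩
  · obtain ⟨e, he, rfl⟩ := List.mem_map.1 hd
    exact (hl e he).smul c
  · rw [List.map_map, List.smul_sum, List.map_map]
    rfl
  · rw [List.map_map, ← List.sum_map_mul_left]
    rfl

theorem exists_hasDecomposition (A : PointedChain n M) : ∃ s, HasDecomposition A s := by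
  classical
  refine DFinsupp.induction (p := fun A : PointedChain n M => ∃ s, HasDecomposition A s) A
    ⟨0, hasDecomposition_zero⟩ ?_
  rintro p α f - - ⟨s, hs⟩
  refine ⟨‖α‖ + s, ?_⟩
  have h := (IsDifferenceChain.order_zero p α).hasDecomposition.add hs
  have he : element p α = DFinsupp.single (β := fun p : M => TangentSpace (𝓡 n) p) p α := by
    unfold element
    congr!
  rw [he] at h
  exact h

theorem bOneNorm_le {A : PointedChain n M} {s : ℝ} (h : HasDecomposition A s) : bOneNorm A ≤ s :=
  csInf_le ⟨0, fun _ ht => HasDecomposition.nonneg ht⟩ h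

theorem le_bOneNorm {A : PointedChain n M} {b : ℝ} (h : ∀ s, HasDecomposition A s → b ≤ s) :
    b ≤ bOneNorm A :=
  le_csInf (exists_hasDecomposition A) h

variable (n M) in
/-- The norm `‖·‖_{B¹}`, as a seminorm on pointed chains. -/
def bOneSeminorm : Seminorm ℝ (PointedChain n M) :=
  Seminorm.ofSMulLE bOneNorm
    (le_antisymm (bOneNorm_le hasDecomposition_zero) (le_bOneNorm fun _ h => h.nonneg))
    (fun A B => by
      have h1 : bOneNorm (A + B) - bOneNorm B ≤ bOneNorm A := le_bOneNorm fun s hs => by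
        have h2 : bOneNorm (A + B) - s ≤ bOneNorm B := le_bOneNorm fun t ht => by
          linarith [bOneNorm_le (hs.add ht)]
        linarith
      linarith)
    (fun c A => by
      rw [Real.norm_eq_abs]
      rcases eq_or_ne c 0 with rfl | hc
      · have := bOneNorm_le (hasDecomposition_zero (n := n) (M := M))
        simpa using this
      · have hc' : 0 < |c| := abs_pos.2 hc
        rw [← div_le_iff₀' hc']
        exact le_bOneNorm fun s hs => by
          rw [div_le_iff₀' hc']
          exact bOneNorm_le (hs.smul c))

instance : SeminormedAddCommGroup (PointedChain n M) :=
  (bOneSeminorm n M).toAddGroupSeminorm.toSeminormedAddCommGroup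

instance : NormedSpace ℝ (PointedChain n M) where
  norm_smul_le c A := (map_smul_eq_mul (bOneSeminorm n M) c A).le

theorem norm_eq_bOneNorm (A : PointedChain n M) : ‖A‖ = bOneNorm A :=
  rfl

variable (n M) in
/-- The Banach space of differential `1`-chains of order `1` on `M`: the completion of the space
of pointed `1`-chains with respect to the norm `‖·‖_{B¹}`. -/
abbrev DifferentialChain : Type _ :=
  UniformSpace.Completion (PointedChain n M)

variable (n M) in
/-- The space `ℬ₁¹(M)` of `1`-forms `θ`, regarded as linear functionals on pointed `1`-chains, for
which `‖θ‖_{B¹}`, the supremum of `|θ(D)| / |D|` over all difference chains `D` of order at most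
`1`, is finite. -/
def FormSpace : Submodule ℝ (PointedChain n M →ₗ[ℝ] ℝ) where
  carrier := {θ | ∃ C : ℝ, ∀ D w, IsDifferenceChain D w → |θ D| ≤ C * w}
  zero_mem' := ⟨0, by simp⟩
  add_mem' := by
    rintro θ η ⟨C, hC⟩ ⟨C', hC'⟩
    refine ⟨C + C', fun D w h => ?_⟩
    rw [LinearMap.add_apply, add_mul]
    exact (abs_add_le _ _).trans (add_le_add (hC D w h) (hC' D w h))
  smul_mem' := by
    rintro c θ ⟨C, hC⟩
    refine ⟨|c| * C, fun D w h => ?_⟩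
    rw [LinearMap.smul_apply, smul_eq_mul, abs_mul, mul_assoc]
    exact mul_le_mul_of_nonneg_left (hC D w h) (abs_nonneg c)

theorem FormSpace.exists_bound (θ : FormSpace n M) :
    ∃ C : ℝ, ∀ A : PointedChain n M, ‖(θ : PointedChain n M →ₗ[ℝ] ℝ) A‖ ≤ C * ‖A‖ := by
  obtain ⟨C, hC⟩ := θ.2
  have hle : ∀ D w, IsDifferenceChain D w →
      |(θ : PointedChain n M →ₗ[ℝ] ℝ) D| ≤ (|C| + 1) * w := fun D w h =>
    (hC D w h).trans (mul_le_mul_of_nonneg_right (by linarith [le_abs_self C]) h.nonneg)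
  have hpos : 0 < |C| + 1 := by positivity
  refine ⟨|C| + 1, fun A => ?_⟩
  rw [norm_eq_bOneNorm, ← div_le_iff₀' hpos]
  refine le_bOneNorm ?_
  rintro s ⟨l, hl, rfl, rfl⟩
  rw [div_le_iff₀' hpos]
  induction l with
  | nil => simp
  | cons d l ih =>
    simp only [List.map_cons, List.sum_cons, map_add, mul_add]
    refine (norm_add_le _ _).trans (add_le_add (hle _ _ (hl d (by simp))) (ih fun e he => ?_))
    exact hl e (by simp [he])

/-- A form in `ℬ₁¹(M)`, as a continuous linear functional on pointed chains. -/
def FormSpace.toContinuousLinearMap (θ : FormSpace n M) : PointedChain n M →L[ℝ] ℝ :=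
  (θ : PointedChain n M →ₗ[ℝ] ℝ).mkContinuousOfExistsBound (FormSpace.exists_bound θ)

/-- The Harrison integral of the form `θ` over the differential chain `ξ`: the value at `ξ` of the
continuous extension of `θ` from pointed chains to differential chains. -/
def harrisonIntegral (ξ : DifferentialChain n M) (θ : FormSpace n M) : ℝ :=
  UniformSpace.Completion.extension (FormSpace.toContinuousLinearMap θ) ξ

theorem continuous_harrisonIntegral (θ : FormSpace n M) :
    Continuous fun ξ : DifferentialChain n M => harrisonIntegral ξ θ :=
  UniformSpace.Completion.continuous_extension

theorem harrisonIntegral_coe (A : PointedChain n M) (θ : FormSpace n M) :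
    harrisonIntegral (A : DifferentialChain n M) θ = (θ : PointedChain n M →ₗ[ℝ] ℝ) A :=
  UniformSpace.Completion.extension_coe (FormSpace.toContinuousLinearMap θ).uniformContinuous A

/-- The interior product `ι_X θ`, i.e. the function `p ↦ θ_p(X_p)`. -/
def interiorProduct (X : ∀ p : M, TangentSpace (𝓡 n) p) (θ : FormSpace n M) (p : M) : ℝ :=
  (θ : PointedChain n M →ₗ[ℝ] ℝ) (element p (X p))

end Chains

end DiffChain

end

/-! The chain is the Bochner integral `∫ (p; X_p) dμ` in the Banach space `DifferentialChain n M`. A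
form in `FormSpace n M` extends to a continuous linear functional there, so it commutes with the
integral, and its value at `(p; X_p)` is `ι_X θ (p)`. Since `M` is compact and `μ` finite on compact
sets, integrability follows once `p ↦ (p; X_p)` is continuous for the `B¹` norm
(`continuous_element`).

For continuity at `x₀`, join `x₀` to a nearby `q` by a short geodesic with initial velocity `T 0`
and transport `X x₀` along it to a vector `V 1` at `q`. Then `(q; X_q) - (x₀; X_{x₀})` is the sum of
`(q; X_q - V 1)` and a difference chain of order one. The second has weight `‖T 0‖ ‖X x₀‖`; the
first is small because both vectors have components close to those of `X x₀` and the metric is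
locally bounded.

The geodesics are found by shooting in a chart (`eventually_exists_joining_solution`). Geodesic and
transport equations form one first order system with equilibrium `(a, 0, w₀)`. The acceleration is
quadratic in the velocity, so near the equilibrium the endpoint is almost a multiple of the initial
velocity, and a quantitative inverse function theorem reaches every nearby point. -/

/-! ### Flows near an equilibrium. -/

section Flow

open Metric NNReal

variable {Y : Type*} [NormedAddCommGroup Y] [NormedSpace ℝ Y] [CompleteSpace Y]

/-- A vector field with Lipschitz constant `1 / 2` around an equilibrium `y₀` has a flow up to
time `1` around `y₀`, which stays close to `y₀` and is Lipschitz in the initial point. -/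
theorem LipschitzOnWith.exists_flow_near_equilibrium {F : Y → Y} {y₀ : Y} {ρ : ℝ≥0}
    (hF : LipschitzOnWith (1 / 2) F (closedBall y₀ ρ)) (h0 : F y₀ = 0) :
    ∃ α : Y → ℝ → Y, (∀ t, α y₀ t = y₀) ∧ ∀ y ∈ closedBall y₀ (ρ / 2 : ℝ), α y 0 = y ∧
      (∀ t ∈ Icc (0 : ℝ) 1, α y t ∈ closedBall y₀ ρ ∧
        HasDerivWithinAt (α y) (F (α y t)) (Icc 0 1) t) ∧
      ∀ t ∈ Icc (0 : ℝ) 1, ∀ y' ∈ closedBall y₀ (ρ / 2 : ℝ),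
        dist (α y t) (α y' t) ≤ 2 * dist y y' := by
  have hmem0 : y₀ ∈ closedBall y₀ (ρ : ℝ) := mem_closedBall_self ρ.2
  -- The field is at most `ρ / 2` on the ball, so in time `1` a curve starting within `ρ / 2` of the
  -- centre stays within `ρ`.
  have hpl : IsPicardLindelof (fun _ => F) (tmin := 0) (tmax := 1) ⟨0, by simp⟩ y₀ ρ (ρ / 2)
      (ρ / 2) (1 / 2) := by
    refine IsPicardLindelof.of_time_independent (fun x hx => ?_) hF ?_
    · have := hF.norm_sub_le hx hmem0
      rw [h0, sub_zero] at this
      rw [mem_closedBall_iff_norm] at hx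
      push_cast at this ⊢
      linarith
    · push_cast
      simp only [sub_zero, sub_self, zero_le_one, max_eq_left, mul_one]
      linarith
  have hex : ∀ y ∈ closedBall y₀ (ρ / 2 : ℝ), ∃ β : ℝ → Y, (y = y₀ → ∀ t, β t = y₀) ∧ β 0 = y ∧
      ∀ t ∈ Icc (0 : ℝ) 1, β t ∈ closedBall y₀ ρ ∧
        HasDerivWithinAt β (F (β t)) (Icc 0 1) t := by
    intro y hy
    -- At the equilibrium the constant curve is chosen by hand, so that it is constant for all `t`,
    -- also outside `[0, 1]`.
    rcases eq_or_ne y y₀ with rfl | hne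
    · refine ⟨fun _ => y, fun _ _ => rfl, rfl, fun t _ => ⟨hmem0, ?_⟩⟩
      rw [h0]
      exact hasDerivWithinAt_const t _ y
    have hy' : y ∈ closedBall y₀ ((ρ / 2 : ℝ≥0) : ℝ) := by simpa using hy
    -- The Picard fixed point itself is kept, since it also records that the curve stays in the
    -- ball.
    obtain ⟨β, hβ⟩ := ODE.FunSpace.exists_isFixedPt_next hpl hy'
    refine ⟨β.compProj, fun h => absurd h hne, ?_, fun t ht => ⟨β.compProj_mem_closedBall hpl.mul_max_le, ?_⟩⟩
    · have := β.compProj_val (t := ⟨0, by simp⟩)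
      rw [← hβ, ODE.FunSpace.next_apply₀] at this
      rw [← hβ]
      exact this
    · apply ODE.hasDerivWithinAt_picard_Icc (⟨0, by simp⟩ : Icc (0 : ℝ) 1).2
        hpl.continuousOn_uncurry β.continuous_compProj.continuousOn
        (fun _ ht' ↦ β.compProj_mem_closedBall hpl.mul_max_le) y ht |>.congr_of_mem _ ht
      intro t' ht'
      nth_rw 1 [← hβ]
      rw [ODE.FunSpace.compProj_of_mem ht', ODE.FunSpace.next_apply]
  choose! α hconst hα0 hα using hex
  refine ⟨α, hconst y₀ (mem_closedBall_self (by positivity)) rfl, fun y hy => ⟨hα0 y hy, hα y hy, fun t ht y' hy' => ?_⟩⟩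
  have hcont : ∀ z ∈ closedBall y₀ (ρ / 2 : ℝ), ContinuousOn (α z) (Icc 0 1) :=
    fun z hz s hs => (hα z hz s hs).2.continuousWithinAt
  have hder : ∀ z ∈ closedBall y₀ (ρ / 2 : ℝ), ∀ s ∈ Ico (0 : ℝ) 1,
      HasDerivWithinAt (α z) (F (α z s)) (Ici s) s := fun z hz s hs =>
    (hα z hz s (Ico_subset_Icc_self hs)).2.mono_of_mem_nhdsWithin
      (Icc_mem_nhdsGE_of_mem hs)
  -- Grönwall's inequality gives the factor `exp (1 / 2) ≤ 2`.
  have key := dist_le_of_trajectories_ODE_of_mem (v := fun _ => F)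
    (s := fun _ => closedBall y₀ (ρ : ℝ)) (K := 1 / 2) (δ := dist y y')
    (fun _ _ => hF) (hcont y hy) (hder y hy)
    (fun s hs => (hα y hy s (Ico_subset_Icc_self hs)).1) (hcont y' hy') (hder y' hy')
    (fun s hs => (hα y' hy' s (Ico_subset_Icc_self hs)).1)
    (by rw [hα0 y hy, hα0 y' hy']) t ht
  refine key.trans ?_
  rw [mul_comm]
  refine mul_le_mul_of_nonneg_right ?_ dist_nonneg
  have h1 : ((1 / 2 : ℝ≥0) : ℝ) * (t - 0) ≤ 1 / 2 := by
    push_cast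
    linarith [ht.2]
  have h2 : Real.exp (1 / 2) ≤ 2 := by
    have h := Real.exp_bound_div_one_sub_of_interval (x := 1 / 2) (by norm_num) (by norm_num)
    norm_num at h ⊢
    exact h
  exact (Real.exp_le_exp.2 h1).trans h2

end Flow

/-! ### Shooting for quadratic second order equations. -/

section Shooting

set_option maxSynthPendingDepth 3

open Metric NNReal

variable {E : Type*} [NormedAddCommGroup E] [NormedSpace ℝ E]

theorem norm_image_sub_image_zero_le_of_hasDerivWithinAt {f f' : ℝ → E} {C : ℝ}
    (hf : ∀ t ∈ Icc (0 : ℝ) 1, HasDerivWithinAt f (f' t) (Icc 0 1) t)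
    (hC : ∀ t ∈ Icc (0 : ℝ) 1, ‖f' t‖ ≤ C) {t : ℝ} (ht : t ∈ Icc (0 : ℝ) 1) :
    ‖f t - f 0‖ ≤ C := by
  have h0 : (0 : ℝ) ∈ Icc (0 : ℝ) 1 := by simp
  have hC0 : 0 ≤ C := (norm_nonneg _).trans (hC 0 h0)
  refine ((convex_Icc (0 : ℝ) 1).norm_image_sub_le_of_norm_hasDerivWithin_le hf hC h0 ht).trans ?_
  rw [sub_zero, Real.norm_of_nonneg ht.1]
  exact mul_le_of_le_one_right hC0 ht.2

/-- The vector field on `E × E × E` whose integral curves `(x, v, w)` are the solutions `x` of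
`x'' = Q x x' x'`, together with their velocity `v` and a solution `w` of the linear equation
`w' = Q x v w`. -/
noncomputable def geodesicField (Q : E → E →L[ℝ] E →L[ℝ] E) (y : E × E × E) : E × E × E :=
  (y.2.1, Q y.1 y.2.1 y.2.1, Q y.1 y.2.1 y.2.2)

variable {Q : E → E →L[ℝ] E →L[ℝ] E} {a : E}

theorem contDiffAt_geodesicField (hQ : ContDiffAt ℝ 1 Q a) (v w : E) :
    ContDiffAt ℝ 1 (geodesicField Q) (a, v, w) := by
  have h1 : ContDiffAt ℝ 1 (fun y : E × E × E => Q y.1) (a, v, w) :=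
    ContDiffAt.comp (a, v, w) (g := Q) hQ contDiffAt_fst
  have h2 : ContDiffAt ℝ 1 (fun y : E × E × E => y.2.1) (a, v, w) := by fun_prop
  have h3 : ContDiffAt ℝ 1 (fun y : E × E × E => y.2.2) (a, v, w) := by fun_prop
  exact h2.prodMk (((h1.clm_apply h2).clm_apply h2).prodMk ((h1.clm_apply h2).clm_apply h3))

/-- Each term of the product rule keeps a factor `l y₀ = 0`. -/
theorem HasStrictFDerivAt.quadratic_apply_zero {Y : Type*} [NormedAddCommGroup Y]
    [NormedSpace ℝ Y] {c : Y → E →L[ℝ] E →L[ℝ] E} {c' : Y →L[ℝ] E →L[ℝ] E →L[ℝ] E} {y₀ : Y}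
    (hc : HasStrictFDerivAt c c' y₀) (l : Y →L[ℝ] E) (hl : l y₀ = 0) :
    HasStrictFDerivAt (fun y => c y (l y) (l y)) (0 : Y →L[ℝ] E) y₀ := by
  have h := (hc.clm_apply l.hasStrictFDerivAt).clm_apply l.hasStrictFDerivAt
  refine h.congr_fderiv (ContinuousLinearMap.ext fun y => ?_)
  simp only [hl, ContinuousLinearMap.comp_apply, map_zero, zero_apply, add_zero]

theorem hasStrictFDerivAt_acceleration (hQ : ContDiffAt ℝ 1 Q a) (w : E) :
    HasStrictFDerivAt (fun y : E × E × E => Q y.1 y.2.1 y.2.1) (0 : E × E × E →L[ℝ] E)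
      (a, 0, w) := by
  have h : HasStrictFDerivAt (fun y : E × E × E => Q y.1) _ (a, (0 : E), w) :=
    HasStrictFDerivAt.comp (a, (0 : E), w) (g := Q) (hQ.hasStrictFDerivAt one_ne_zero)
      hasStrictFDerivAt_fst
  exact h.quadratic_apply_zero
    ((ContinuousLinearMap.fst ℝ E E).comp (ContinuousLinearMap.snd ℝ E (E × E))) rfl

variable [CompleteSpace E]

/-- For a quadratic second order equation `x'' = Q x x' x'`, all points `b` near `a` are joined to
`a` by a solution, short enough for the solutions of `w' = Q x x' w` not to move much. -/
theorem eventually_exists_joining_solution (hQ : ContDiffAt ℝ 1 Q a) (w₀ : E) {U : Set E}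
    (hU : U ∈ 𝓝 a) {η : ℝ} (hη : 0 < η) :
    ∀ᶠ b in 𝓝 a, ∃ x v w : ℝ → E, x 0 = a ∧ x 1 = b ∧ w 0 = w₀ ∧ ‖v 0‖ < η ∧
      ‖w 1 - w₀‖ < η ∧ ∀ t ∈ Icc (0 : ℝ) 1, x t ∈ U ∧
        HasDerivWithinAt x (v t) (Icc 0 1) t ∧
        HasDerivWithinAt v (Q (x t) (v t) (v t)) (Icc 0 1) t ∧
        HasDerivWithinAt w (Q (x t) (v t) (w t)) (Icc 0 1) t := by
  obtain ⟨K, s, hs, hK⟩ := (contDiffAt_geodesicField hQ 0 w₀).exists_lipschitzOnWith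
  -- The derivative is zero, so any positive Lipschitz constant is available; `1 / 8` times the
  -- constant `2` of the flow gives the `1 / 4` in `hvel`.
  obtain ⟨s', hs', hP⟩ := (hasStrictFDerivAt_acceleration hQ w₀).exists_lipschitzOnWith_of_nnnorm_lt
    (1 / 8) (by simp)
  have hU' : (fun y : E × E × E => y.1) ⁻¹' U ∈ 𝓝 (a, (0 : E), w₀) :=
    continuousAt_fst.preimage_mem_nhds hU
  obtain ⟨r, hr, hrs⟩ := nhds_basis_closedBall.mem_iff.1
    (Filter.inter_mem (Filter.inter_mem hs hs') hU')
  lift r to ℝ≥0 using hr.le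
  set y₀ : E × E × E := (a, 0, w₀) with hy₀
  -- Slowing time down by `ε` brings the Lipschitz constant `K` below `1 / 2`.
  set ε : ℝ := 1 / (2 * (K + 1)) with hε
  have hK0 : (0 : ℝ) ≤ K := K.2
  have hεpos : 0 < ε := by positivity
  have hε1 : ε ≤ 1 := by
    rw [hε, div_le_one (by positivity)]
    linarith
  have hεK : ε * K ≤ 1 / 2 := by
    rw [hε, div_mul_eq_mul_div, div_le_iff₀ (by positivity)]
    linarith
  have hlip : LipschitzOnWith (1 / 2) (fun y => ε • geodesicField Q y) (closedBall y₀ r) := by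
    refine LipschitzOnWith.of_dist_le_mul fun y hy z hz => ?_
    rw [dist_smul₀, Real.norm_of_nonneg hεpos.le]
    have := hK.dist_le_mul y (hrs hy).1.1 z (hrs hz).1.1
    push_cast
    nlinarith [dist_nonneg (x := y) (y := z)]
  obtain ⟨α, hαconst, hα⟩ := hlip.exists_flow_near_equilibrium (by simp [geodesicField, hy₀])
  -- `r / 2` is the radius of admissible initial points; `η / 4` bounds the initial velocity and,
  -- through the flow's constant `2`, the motion of `w`.
  set δ : ℝ := min (r / 2) (η / 4) with hδ
  have hδpos : 0 < δ := by positivity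
  have hδr : δ ≤ r / 2 := min_le_left _ _
  have hδη : δ ≤ η / 4 := min_le_right _ _
  have hdist : ∀ u u' : E, dist ((a, u, w₀) : E × E × E) (a, u', w₀) = ‖u - u'‖ := by
    intro u u'
    simp [dist_eq_norm]
  have hstart : ∀ u ∈ closedBall (0 : E) δ,
      ((a, u, w₀) : E × E × E) ∈ closedBall y₀ (r / 2 : ℝ) := by
    intro u hu
    rw [mem_closedBall, hdist]
    rw [mem_closedBall, dist_eq_norm] at hu
    exact hu.trans hδr
  set β : E → ℝ → E × E × E := fun u => α (a, u, w₀) with hβ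
  have hβ0 : ∀ u ∈ closedBall (0 : E) δ, β u 0 = (a, u, w₀) := fun u hu => (hα _ (hstart u hu)).1
  have hβmem : ∀ u ∈ closedBall (0 : E) δ, ∀ t ∈ Icc (0 : ℝ) 1, β u t ∈ closedBall y₀ r :=
    fun u hu t ht => ((hα _ (hstart u hu)).2.1 t ht).1
  have hβder : ∀ u ∈ closedBall (0 : E) δ, ∀ t ∈ Icc (0 : ℝ) 1,
      HasDerivWithinAt (β u) (ε • geodesicField Q (β u t)) (Icc 0 1) t :=
    fun u hu t ht => ((hα _ (hstart u hu)).2.1 t ht).2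
  have hβdist : ∀ u ∈ closedBall (0 : E) δ, ∀ u' ∈ closedBall (0 : E) δ, ∀ t ∈ Icc (0 : ℝ) 1,
      ‖β u t - β u' t‖ ≤ 2 * ‖u - u'‖ := by
    intro u hu u' hu' t ht
    rw [← dist_eq_norm, ← hdist]
    exact (hα _ (hstart u hu)).2.2 t ht _ (hstart u' hu')
  have hx : ∀ u ∈ closedBall (0 : E) δ, ∀ t ∈ Icc (0 : ℝ) 1,
      HasDerivWithinAt (fun t => (β u t).1) (ε • (β u t).2.1) (Icc 0 1) t :=
    fun u hu t ht => (hβder u hu t ht).fst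
  have hv : ∀ u ∈ closedBall (0 : E) δ, ∀ t ∈ Icc (0 : ℝ) 1,
      HasDerivWithinAt (fun t => (β u t).2.1) (ε • Q (β u t).1 (β u t).2.1 (β u t).2.1)
        (Icc 0 1) t :=
    fun u hu t ht => (hβder u hu t ht).snd.fst
  have hw : ∀ u ∈ closedBall (0 : E) δ, ∀ t ∈ Icc (0 : ℝ) 1,
      HasDerivWithinAt (fun t => (β u t).2.2) (ε • Q (β u t).1 (β u t).2.1 (β u t).2.2)
        (Icc 0 1) t :=
    fun u hu t ht => (hβder u hu t ht).snd.snd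
  have h0mem : (0 : E) ∈ closedBall (0 : E) δ := mem_closedBall_self hδpos.le
  have hone : (1 : ℝ) ∈ Icc (0 : ℝ) 1 := by simp
  have hconst : ∀ t, β 0 t = y₀ := hαconst
  have hvel : ∀ u ∈ closedBall (0 : E) δ, ∀ u' ∈ closedBall (0 : E) δ, ∀ t ∈ Icc (0 : ℝ) 1,
      ‖(β u t).2.1 - (β u' t).2.1 - (u - u')‖ ≤ 1 / 4 * ‖u - u'‖ := by
    intro u hu u' hu' t ht
    have := norm_image_sub_image_zero_le_of_hasDerivWithinAt (C := 1 / 4 * ‖u - u'‖)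
      (fun s hs => (hv u hu s hs).sub (hv u' hu' s hs)) (fun s hs => ?_) ht
    · simpa [hβ0 u hu, hβ0 u' hu'] using this
    · rw [← smul_sub, norm_smul, Real.norm_of_nonneg hεpos.le]
      have h1 := hP.norm_sub_le (hrs (hβmem u hu s hs)).1.2 (hrs (hβmem u' hu' s hs)).1.2
      have h2 := hβdist u hu u' hu' s hs
      push_cast at h1
      refine (mul_le_of_le_one_left (norm_nonneg _) hε1).trans ?_
      linarith
  have hpos : ∀ u ∈ closedBall (0 : E) δ, ∀ u' ∈ closedBall (0 : E) δ,
      ‖(β u 1).1 - (β u' 1).1 - ε • (u - u')‖ ≤ ε / 4 * ‖u - u'‖ := by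
    intro u hu u' hu'
    have := norm_image_sub_image_zero_le_of_hasDerivWithinAt (C := ε / 4 * ‖u - u'‖)
      (fun s hs => ((hx u hu s hs).sub (hx u' hu' s hs)).sub
        ((hasDerivWithinAt_id s (Icc 0 1)).smul_const (ε • (u - u')))) (fun s hs => ?_) hone
    · simpa [hβ0 u hu, hβ0 u' hu'] using this
    · rw [one_smul, ← smul_sub, ← smul_sub, norm_smul, Real.norm_of_nonneg hεpos.le]
      have := hvel u hu u' hu' s hs
      nlinarith
  let R : (ε • ContinuousLinearMap.id ℝ E).NonlinearRightInverse :=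
    { toFun := fun y => ε⁻¹ • y
      nnnorm := NNReal.mk ε⁻¹ (by positivity)
      bound' := fun y => by
        rw [norm_smul, norm_inv, Real.norm_of_nonneg hεpos.le]
        rfl
      right_inv' := fun y => by simp [smul_smul, hεpos.ne'] }
  have happ : ApproximatesLinearOn (fun u => (β u 1).1) (ε • ContinuousLinearMap.id ℝ E)
      (closedBall 0 δ) (NNReal.mk (ε / 4) (by positivity)) :=
    fun u hu u' hu' => hpos u hu u' hu'
  have hsurj := happ.surjOn_closedBall_of_nonlinearRightInverse R hδpos.le Subset.rfl
  -- The endpoint map is within `ε / 4` of `ε • id`, so it covers a ball of radius `(ε - ε / 4) *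
  -- δ`.
  have hball : closedBall a (3 / 4 * ε * δ) ∈ 𝓝 a := closedBall_mem_nhds _ (by positivity)
  filter_upwards [hball] with b hb
  obtain ⟨u, hu, hub⟩ := hsurj (a := b) (by
    have : (R.nnnorm : ℝ) = ε⁻¹ := rfl
    rw [this, hconst 1]
    convert! hb using 2
    rw [inv_inv, NNReal.coe_mk]
    ring)
  have hunorm : ‖u‖ ≤ δ := by simpa using hu
  refine ⟨fun t => (β u t).1, fun t => ε • (β u t).2.1, fun t => (β u t).2.2,
    by simp [hβ0 u hu], hub, by simp [hβ0 u hu], ?_, ?_, fun t ht =>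
    ⟨(hrs (hβmem u hu t ht)).2, hx u hu t ht, ?_, ?_⟩⟩
  · simp only [hβ0 u hu, norm_smul, Real.norm_of_nonneg hεpos.le]
    refine (mul_le_of_le_one_left (norm_nonneg _) hε1).trans_lt ?_
    linarith
  · have h1 := hβdist u hu 0 h0mem 1 hone
    rw [hconst 1, sub_zero] at h1
    have h2 : ‖(β u 1).2.2 - w₀‖ ≤ ‖β u 1 - y₀‖ :=
      (norm_snd_le (β u 1 - y₀).2).trans (norm_snd_le (β u 1 - y₀))
    linarith
  -- The velocity in slowed time is `ε` times the second component; as `Q` is bilinear, both factors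
  -- `ε` are absorbed.
  · have := (hv u hu t ht).const_smul ε
    simp only [map_smul, smul_apply]
    exact this
  · simpa [smul_smul] using hw u hu t ht

end Shooting

/-! ### Christoffel symbols in a normed space. -/

section LeviCivita

set_option maxSynthPendingDepth 3

variable {E : Type*} [NormedAddCommGroup E] [NormedSpace ℝ E]

/-- The Christoffel symbols of the first kind of the metric `G` on an open subset of a normed
space, as a trilinear form. -/
noncomputable def christoffelForm (G : E → E →L[ℝ] E →L[ℝ] ℝ) (y : E) :
    E →L[ℝ] E →L[ℝ] E →L[ℝ] ℝ :=
  (2⁻¹ : ℝ) • (fderiv ℝ G y + (fderiv ℝ G y).flip -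
    ((ContinuousLinearMap.flipₗᵢ ℝ E E ℝ).toContinuousLinearEquiv :
      (E →L[ℝ] E →L[ℝ] ℝ) →L[ℝ] (E →L[ℝ] E →L[ℝ] ℝ)).comp (fderiv ℝ G y).flip)

theorem christoffelForm_apply (G : E → E →L[ℝ] E →L[ℝ] ℝ) (y a b c : E) :
    christoffelForm G y a b c =
      (fderiv ℝ G y a b c + fderiv ℝ G y b a c - fderiv ℝ G y c a b) / 2 := by
  rw [div_eq_inv_mul]
  rfl

set_option synthInstance.maxHeartbeats 100000 in
theorem contDiffAt_christoffelForm {G : E → E →L[ℝ] E →L[ℝ] ℝ} {y : E}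
    (hG : ContDiffAt ℝ 2 G y) : ContDiffAt ℝ 1 (christoffelForm G) y := by
  have h : ContDiffAt ℝ 1 (fderiv ℝ G) y := hG.fderiv_right (m := 1) (by norm_num)
  have h' : ContDiffAt ℝ 1 (fun z => (fderiv ℝ G z).flip) y :=
    (ContinuousLinearMap.flipₗᵢ ℝ E E (E →L[ℝ] ℝ)).contDiff.contDiffAt.comp y h
  exact ((h.add h').sub (contDiffAt_const.clm_comp h')).const_smul _

/-- The acceleration of the geodesics of the metric `G`: minus the Christoffel symbols of the
second kind. -/
noncomputable def geodesicAcceleration (G : E → E →L[ℝ] E →L[ℝ] ℝ) (y : E) : E →L[ℝ] E →L[ℝ] E :=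
  (ContinuousLinearMap.compL ℝ E (E →L[ℝ] ℝ) E (-(G y).inverse)).comp (christoffelForm G y)

/-- Raising the index solves the transport equation, which is stated tested against `c`, for the
derivative. -/
theorem metric_geodesicAcceleration {G : E → E →L[ℝ] E →L[ℝ] ℝ} {y : E}
    (hy : (G y).IsInvertible) (a b c : E) :
    G y (geodesicAcceleration G y a b) c + christoffelForm G y a b c = 0 := by
  have h : G y (geodesicAcceleration G y a b) = -christoffelForm G y a b := by
    obtain ⟨e, he⟩ := hy
    have h1 : geodesicAcceleration G y a b = -(G y).inverse (christoffelForm G y a b) := rfl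
    rw [h1, ← he, ContinuousLinearMap.inverse_equiv]
    exact (map_neg e _).trans (congrArg Neg.neg (e.apply_symm_apply _))
  rw [h]
  exact neg_add_cancel _

/-- The Christoffel symbols cost one derivative of `G`, and inversion is smooth at invertible
operators. -/
theorem contDiffAt_geodesicAcceleration [CompleteSpace E] {G : E → E →L[ℝ] E →L[ℝ] ℝ} {y : E}
    (hG : ContDiffAt ℝ 2 G y) (hy : (G y).IsInvertible) :
    ContDiffAt ℝ 1 (geodesicAcceleration G) y := by
  have hinv : ContDiffAt ℝ 1 (fun z => (G z).inverse) y := by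
    obtain ⟨e, he⟩ := hy
    have h := contDiffAt_map_inverse (n := 1) e
    rw [he] at h
    exact h.comp y (hG.of_le one_le_two)
  have h2 : ContDiffAt ℝ 1 (fun z => ContinuousLinearMap.compL ℝ E (E →L[ℝ] ℝ) E
      (-(G z).inverse)) y :=
    (ContinuousLinearMap.compL ℝ E (E →L[ℝ] ℝ) E).contDiff.contDiffAt.comp y hinv.neg
  exact h2.clm_comp (contDiffAt_christoffelForm hG)

end LeviCivita

noncomputable section

namespace DiffChain

/-! ### The metric in a chart. -/

section ChristoffelSymbols

set_option maxSynthPendingDepth 3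

variable {n : ℕ} {M : Type*} [TopologicalSpace M] [ChartedSpace (EuclideanSpace ℝ (Fin n)) M]
  [IsManifold (𝓡 n) ∞ M]

theorem ofChartComponents_chartComponents {x₀ q : M}
    (hq : q ∈ (chartAt (EuclideanSpace ℝ (Fin n)) x₀).source) (v : TangentSpace (𝓡 n) q) :
    ofChartComponents x₀ q (chartComponents x₀ q v) = v :=
  Trivialization.symmL_continuousLinearMapAt _ (by simpa using hq) v

theorem chartComponents_ofChartComponents {x₀ q : M}
    (hq : q ∈ (chartAt (EuclideanSpace ℝ (Fin n)) x₀).source) (a : EuclideanSpace ℝ (Fin n)) :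
    chartComponents x₀ q (ofChartComponents x₀ q a) = a :=
  Trivialization.continuousLinearMapAt_symmL _ (by simpa using hq) a

/-- The metric coefficients are inner products of two such fields, so they inherit this smoothness.
-/
theorem contMDiffAt_ofChartComponents {x₀ : M} {y : EuclideanSpace ℝ (Fin n)}
    (hy : y ∈ (extChartAt (𝓡 n) x₀).target) (a : EuclideanSpace ℝ (Fin n)) :
    ContMDiffAt 𝓘(ℝ, EuclideanSpace ℝ (Fin n)) ((𝓡 n).prod 𝓘(ℝ, EuclideanSpace ℝ (Fin n))) ∞
      (fun z => (⟨(extChartAt (𝓡 n) x₀).symm z, ofChartComponents x₀ _ a⟩ :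
        TangentBundle (𝓡 n) M)) y := by
  have hopen : IsOpen (extChartAt (𝓡 n) x₀).target := isOpen_extChartAt_target x₀
  have h1 : ContMDiffAt 𝓘(ℝ, EuclideanSpace ℝ (Fin n)) (𝓡 n) ∞ (extChartAt (𝓡 n) x₀).symm y :=
    (contMDiffOn_extChartAt_symm x₀).contMDiffAt (hopen.mem_nhds hy)
  have hmem : ∀ z ∈ (extChartAt (𝓡 n) x₀).target, (extChartAt (𝓡 n) x₀).symm z ∈
      (trivializationAt (EuclideanSpace ℝ (Fin n)) (TangentSpace (𝓡 n)) x₀).baseSet := by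
    intro z hz
    simpa using (extChartAt (𝓡 n) x₀).map_target hz
  refine ((Trivialization.contMDiffOn_symm
    (trivializationAt (EuclideanSpace ℝ (Fin n)) (TangentSpace (𝓡 n)) x₀)).contMDiffAt
    (x := ((extChartAt (𝓡 n) x₀).symm y, a)) ?_).comp y
    (h1.prodMk (contMDiffAt_const (c := a))) |>.congr_of_eventuallyEq ?_
  · refine (OpenPartialHomeomorph.open_target _).mem_nhds ?_
    exact (Trivialization.mem_target _).2 (hmem y hy)
  · filter_upwards [hopen.mem_nhds hy] with z hz
    have := Trivialization.mk_symm _ (hmem z hz) a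
    rw [← Trivialization.symmL_apply (R := ℝ) _ (hmem z hz)] at this
    exact this

variable [RiemannianBundle (fun x : M => TangentSpace (𝓡 n) x)]

/-- The metric tensor in the coordinates of the chart at `x₀`, as a bilinear form. -/
def chartMetricForm (x₀ : M) (y : EuclideanSpace ℝ (Fin n)) :
    EuclideanSpace ℝ (Fin n) →L[ℝ] EuclideanSpace ℝ (Fin n) →L[ℝ] ℝ :=
  LinearMap.toContinuousLinearMap
    { toFun := fun a => LinearMap.toContinuousLinearMap
        { toFun := fun b => chartMetric x₀ y a b
          map_add' := fun b b' => by
            simp only [chartMetric, ofChartComponents, map_add]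
            exact inner_add_right (𝕜 := ℝ)
              (E := TangentSpace (𝓡 n) ((extChartAt (𝓡 n) x₀).symm y)) _ _ _
          map_smul' := fun k b => chartMetric_smul_right x₀ y k a b }
      map_add' := fun a a' => by
        ext b
        simp only [chartMetric, ofChartComponents, map_add]
        exact inner_add_left (𝕜 := ℝ)
          (E := TangentSpace (𝓡 n) ((extChartAt (𝓡 n) x₀).symm y)) _ _ _
      map_smul' := fun k a => by
        ext b
        exact chartMetric_smul_left x₀ y k a b }

theorem chartMetricForm_apply (x₀ : M) (y a b : EuclideanSpace ℝ (Fin n)) :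
    chartMetricForm x₀ y a b = chartMetric x₀ y a b :=
  rfl

/-- Positive definiteness gives injectivity, and the space and its dual have the same finite
dimension. -/
theorem isInvertible_chartMetricForm {x₀ : M} {y : EuclideanSpace ℝ (Fin n)}
    (hy : y ∈ (extChartAt (𝓡 n) x₀).target) : (chartMetricForm x₀ y).IsInvertible := by
  have hinj : Function.Injective
      (chartMetricForm x₀ y : EuclideanSpace ℝ (Fin n) →ₗ[ℝ] EuclideanSpace ℝ (Fin n) →L[ℝ] ℝ) := by
    rw [injective_iff_map_eq_zero]
    intro a ha
    have h1 : chartMetric x₀ y a a = 0 := by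
      rw [← chartMetricForm_apply]
      exact DFunLike.congr_fun ha a
    have h2 : ofChartComponents x₀ ((extChartAt (𝓡 n) x₀).symm y) a = 0 :=
      inner_self_eq_zero.1 h1
    rw [← chartComponents_ofChartComponents (x₀ := x₀) (q := (extChartAt (𝓡 n) x₀).symm y)
      (by simpa using (extChartAt (𝓡 n) x₀).map_target hy) a, h2]
    exact map_zero _
  have hdim : Module.finrank ℝ (EuclideanSpace ℝ (Fin n)) =
      Module.finrank ℝ (EuclideanSpace ℝ (Fin n) →L[ℝ] ℝ) := by
    rw [← (LinearMap.toContinuousLinearMap (𝕜 := ℝ) (E := EuclideanSpace ℝ (Fin n))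
      (F' := ℝ)).finrank_eq]
    exact Subspace.dual_finrank_eq.symm
  exact ⟨(LinearEquiv.ofInjectiveOfFinrankEq _ hinj hdim).toContinuousLinearEquiv, by ext; rfl⟩

variable [IsContMDiffRiemannianBundle (𝓡 n) ∞ (EuclideanSpace ℝ (Fin n))
  (fun x : M => TangentSpace (𝓡 n) x)]

theorem contDiffAt_chartMetric {x₀ : M} {y : EuclideanSpace ℝ (Fin n)}
    (hy : y ∈ (extChartAt (𝓡 n) x₀).target) (a b : EuclideanSpace ℝ (Fin n)) :
    ContDiffAt ℝ ∞ (fun z => chartMetric x₀ z a b) y :=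
  contMDiffAt_iff_contDiffAt.1 ((contMDiffAt_ofChartComponents hy a).inner_bundle
    (contMDiffAt_ofChartComponents hy b))

theorem contDiffOn_chartMetricForm (x₀ : M) :
    ContDiffOn ℝ ∞ (chartMetricForm (n := n) x₀) (extChartAt (𝓡 n) x₀).target :=
  contDiffOn_clm_apply.2 fun a => contDiffOn_clm_apply.2 fun b _ hy =>
    (contDiffAt_chartMetric hy a b).contDiffWithinAt

theorem contDiffAt_chartMetricForm {x₀ : M} {y : EuclideanSpace ℝ (Fin n)}
    (hy : y ∈ (extChartAt (𝓡 n) x₀).target) : ContDiffAt ℝ ∞ (chartMetricForm x₀) y :=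
  (contDiffOn_chartMetricForm x₀).contDiffAt ((isOpen_extChartAt_target x₀).mem_nhds hy)

theorem fderiv_chartMetricForm_apply {x₀ : M} {y : EuclideanSpace ℝ (Fin n)}
    (hy : y ∈ (extChartAt (𝓡 n) x₀).target) (a b c : EuclideanSpace ℝ (Fin n)) :
    fderiv ℝ (chartMetricForm x₀) y c a b = chartMetricDeriv x₀ y c a b := by
  have h := ((contDiffAt_chartMetricForm hy).differentiableAt (by simp)).hasFDerivAt
  have h2 := (((h.clm_apply (hasFDerivAt_const a y)).clm_apply (hasFDerivAt_const b y))).fderiv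
  simp only [chartMetricForm_apply] at h2
  rw [chartMetricDeriv, h2]
  simp

theorem christoffelForm_chartMetricForm {x₀ : M} {y : EuclideanSpace ℝ (Fin n)}
    (hy : y ∈ (extChartAt (𝓡 n) x₀).target) (a b c : EuclideanSpace ℝ (Fin n)) :
    christoffelForm (chartMetricForm x₀) y a b c = chartChristoffel x₀ y a b c := by
  simp only [christoffelForm_apply, chartChristoffel, fderiv_chartMetricForm_apply hy]

theorem chartMetric_geodesicAcceleration {x₀ : M} {y : EuclideanSpace ℝ (Fin n)}
    (hy : y ∈ (extChartAt (𝓡 n) x₀).target) (a b c : EuclideanSpace ℝ (Fin n)) :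
    chartMetric x₀ y (geodesicAcceleration (chartMetricForm x₀) y a b) c +
      chartChristoffel x₀ y a b c = 0 := by
  rw [← chartMetricForm_apply, ← christoffelForm_chartMetricForm hy]
  exact metric_geodesicAcceleration (isInvertible_chartMetricForm hy) a b c

end ChristoffelSymbols

/-! ### Short geodesics and parallel transport. -/

section Geodesics

set_option maxSynthPendingDepth 3

variable {n : ℕ} {M : Type*} [TopologicalSpace M] [ChartedSpace (EuclideanSpace ℝ (Fin n)) M]
  [IsManifold (𝓡 n) ∞ M]

/-- On the chart domain `symmL` is the derivative of the inverse chart, so this is the chain rule.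
-/
theorem isVelocityField_extChartAt_symm {x₀ : M} {x v : ℝ → EuclideanSpace ℝ (Fin n)}
    (hx : ∀ t ∈ Icc (0 : ℝ) 1, x t ∈ (extChartAt (𝓡 n) x₀).target)
    (hv : ∀ t ∈ Icc (0 : ℝ) 1, HasDerivWithinAt x (v t) (Icc 0 1) t) :
    IsVelocityField (fun t => (extChartAt (𝓡 n) x₀).symm (x t))
      (fun t => ofChartComponents x₀ _ (v t)) := by
  intro t ht
  have hsrc : (extChartAt (𝓡 n) x₀).symm (x t) ∈
      (chartAt (EuclideanSpace ℝ (Fin n)) x₀).source := by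
    simpa using (extChartAt (𝓡 n) x₀).map_target (hx t ht)
  have h1 : HasMFDerivAt 𝓘(ℝ, EuclideanSpace ℝ (Fin n)) (𝓡 n) (extChartAt (𝓡 n) x₀).symm (x t)
      ((trivializationAt (EuclideanSpace ℝ (Fin n)) (TangentSpace (𝓡 n)) x₀).symmL ℝ
        ((extChartAt (𝓡 n) x₀).symm (x t))) := by
    have := (mdifferentiableWithinAt_extChartAt_symm (I := 𝓡 n) (hx t ht)).hasMFDerivWithinAt
    rw [TangentBundle.symmL_trivializationAt hsrc]
    rw [(extChartAt (𝓡 n) x₀).right_inv (hx t ht)]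
    simpa using this
  have h2 : HasMFDerivWithinAt 𝓘(ℝ, ℝ) 𝓘(ℝ, EuclideanSpace ℝ (Fin n)) x (Icc 0 1) t
      ((ContinuousLinearMap.id ℝ ℝ).smulRight (v t)) := by
    have := (hv t ht).hasFDerivWithinAt.hasMFDerivWithinAt
    convert! this using 1
  have h3 := h1.comp_hasMFDerivWithinAt t h2
  refine h3.congr_mfderiv (ContinuousLinearMap.ext fun k => ?_)
  exact (map_smul ((trivializationAt (EuclideanSpace ℝ (Fin n)) (TangentSpace (𝓡 n)) x₀).symmL ℝ
    ((extChartAt (𝓡 n) x₀).symm (x t))) (show ℝ from k) (v t))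

variable [RiemannianBundle (fun x : M => TangentSpace (𝓡 n) x)]
  [IsContMDiffRiemannianBundle (𝓡 n) ∞ (EuclideanSpace ℝ (Fin n))
    (fun x : M => TangentSpace (𝓡 n) x)]

/-- The case `w = v` is the geodesic equation. -/
theorem isParallel_extChartAt_symm {x₀ : M} {x v w : ℝ → EuclideanSpace ℝ (Fin n)}
    (hx : ∀ t ∈ Icc (0 : ℝ) 1, x t ∈ (extChartAt (𝓡 n) x₀).target)
    (hw : ∀ t ∈ Icc (0 : ℝ) 1, HasDerivWithinAt w
      (geodesicAcceleration (chartMetricForm x₀) (x t) (v t) (w t)) (Icc 0 1) t) :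
    IsParallel (fun t => (extChartAt (𝓡 n) x₀).symm (x t))
      (fun t => ofChartComponents x₀ _ (v t)) (fun t => ofChartComponents x₀ _ (w t)) := by
  have hsrc : ∀ t ∈ Icc (0 : ℝ) 1, (extChartAt (𝓡 n) x₀).symm (x t) ∈
      (chartAt (EuclideanSpace ℝ (Fin n)) x₀).source := fun t ht => by
    simpa using (extChartAt (𝓡 n) x₀).map_target (hx t ht)
  intro t ht
  refine ⟨x₀, hsrc t ht, _, (hw t ht).congr_of_mem
    (fun s hs => chartComponents_ofChartComponents (hsrc s hs) (w s)) ht, fun c => ?_⟩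
  rw [chartComponents_ofChartComponents (hsrc t ht), chartComponents_ofChartComponents (hsrc t ht),
    (extChartAt (𝓡 n) x₀).right_inv (hx t ht)]
  exact chartMetric_geodesicAcceleration (hx t ht) _ _ c

/-- All points near `x₀` are joined to `x₀` by a short geodesic; along it, the parallel transport
of a vector at `x₀` nearly keeps its components in the chart at `x₀`. -/
theorem eventually_exists_geodesic (x₀ : M) (α : TangentSpace (𝓡 n) x₀) {η : ℝ} (hη : 0 < η) :
    ∀ᶠ q in 𝓝 x₀, ∃ (γ : ℝ → M) (T V : ∀ t, TangentSpace (𝓡 n) (γ t)),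
      IsGeodesic γ T ∧ IsParallel γ T V ∧ γ 0 = x₀ ∧ γ 1 = q ∧ ‖T 0‖ ≤ η ∧
      element (γ 0) (V 0) = element x₀ α ∧ ‖V 0‖ = ‖α‖ ∧
      ∃ a, element (γ 1) (V 1) = element q (ofChartComponents x₀ q a) ∧
        ‖a - chartComponents x₀ x₀ α‖ ≤ η := by
  have hmem : extChartAt (𝓡 n) x₀ x₀ ∈ (extChartAt (𝓡 n) x₀).target :=
    mem_extChartAt_target x₀
  set L := (trivializationAt (EuclideanSpace ℝ (Fin n)) (TangentSpace (𝓡 n)) x₀).symmL ℝ x₀ with hL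
  -- `L` turns components at `x₀` into vectors, so `‖T 0‖ ≤ ‖L‖ * ‖v 0‖`.
  have hη' : 0 < η / (‖L‖ + 1) := by positivity
  have h := eventually_exists_joining_solution
    (contDiffAt_geodesicAcceleration ((contDiffAt_chartMetricForm hmem).of_le (by norm_cast))
      (isInvertible_chartMetricForm hmem))
    (chartComponents x₀ x₀ α) ((isOpen_extChartAt_target x₀).mem_nhds hmem) hη'
  filter_upwards [(continuousAt_extChartAt (I := 𝓡 n) x₀).eventually h,
    extChartAt_source_mem_nhds (I := 𝓡 n) x₀] with q hq hqs
  obtain ⟨x, v, w, hx0, hx1, hw0, hv0, hw1, hode⟩ := hq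
  have hγ0 : (extChartAt (𝓡 n) x₀).symm (x 0) = x₀ := by rw [hx0]; simp
  have hγ1 : (extChartAt (𝓡 n) x₀).symm (x 1) = q := by
    rw [hx1, (extChartAt (𝓡 n) x₀).left_inv hqs]
  have hα : ofChartComponents x₀ x₀ (w 0) = α := by
    rw [hw0, ofChartComponents_chartComponents (by simp)]
  have hle : η / (‖L‖ + 1) ≤ η := div_le_self hη.le (by linarith [norm_nonneg L])
  refine ⟨_, _, fun t => ofChartComponents x₀ _ (w t),
    ⟨isVelocityField_extChartAt_symm (fun t ht => (hode t ht).1) fun t ht => (hode t ht).2.1,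
      isParallel_extChartAt_symm (fun t ht => (hode t ht).1) fun t ht => (hode t ht).2.2.1⟩,
    isParallel_extChartAt_symm (fun t ht => (hode t ht).1) fun t ht => (hode t ht).2.2.2,
    hγ0, hγ1, ?_, ?_, ?_, w 1, ?_, ?_⟩
  · have h0 : ‖ofChartComponents x₀ x₀ (v 0)‖ ≤ η := by
      refine (L.le_opNorm (v 0)).trans ?_
      rw [lt_div_iff₀ (by positivity)] at hv0
      nlinarith [norm_nonneg (v 0), norm_nonneg L]
    -- `γ 0` equals `x₀` only propositionally, so the estimate is transported between fibres by
    -- generalizing the base point.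
    have h1 : ∀ p, p = x₀ → ‖ofChartComponents x₀ p (v 0)‖ ≤ η := fun p hp => hp ▸ h0
    exact h1 _ hγ0
  · rw [← hα]
    exact congrArg (fun p => element p (ofChartComponents x₀ p (w 0))) hγ0
  · rw [← hα]
    exact congrArg (fun p => ‖ofChartComponents x₀ p (w 0)‖) hγ0
  · exact congrArg (fun p => element p (ofChartComponents x₀ p (w 1))) hγ1
  · exact hw1.le.trans hle

end Geodesics

/-! ### Continuity of `p ↦ (p; X_p)`. -/

section Continuity

set_option maxSynthPendingDepth 3

variable {n : ℕ} {M : Type*} [TopologicalSpace M] [ChartedSpace (EuclideanSpace ℝ (Fin n)) M]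

theorem element_sub (p : M) (α β : TangentSpace (𝓡 n) p) :
    element p (α - β) = element p α - element p β := by
  classical
  exact DFinsupp.single_sub (β := fun p : M => TangentSpace (𝓡 n) p) p α β

variable [IsManifold (𝓡 n) ∞ M]

theorem IsLipschitzVectorField.tendsto_chartComponents {X : ∀ p : M, TangentSpace (𝓡 n) p}
    (hX : IsLipschitzVectorField X) (x₀ : M) :
    Filter.Tendsto (fun q => chartComponents x₀ q (X q)) (𝓝 x₀)
      (𝓝 (chartComponents x₀ x₀ (X x₀))) := by
  obtain ⟨K, s, hs, hK⟩ := hX x₀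
  have h := (hK.continuousOn.continuousAt hs).comp (continuousAt_extChartAt (I := 𝓡 n) x₀)
  have hc : ContinuousAt (fun q => chartComponents x₀ q (X q)) x₀ := by
    refine h.congr_of_eventuallyEq ?_
    filter_upwards [extChartAt_source_mem_nhds (I := 𝓡 n) x₀] with q hq
    exact (congrArg (fun p => chartComponents x₀ p (X p)) ((extChartAt (𝓡 n) x₀).left_inv hq)).symm
  exact hc

variable [RiemannianBundle (fun x : M => TangentSpace (𝓡 n) x)]

theorem norm_element_le (p : M) (α : TangentSpace (𝓡 n) p) : ‖element p α‖ ≤ ‖α‖ :=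
  bOneNorm_le (IsDifferenceChain.order_zero p α).hasDecomposition

theorem norm_element_sub_element_le {γ : ℝ → M} {T V : ∀ t, TangentSpace (𝓡 n) (γ t)}
    (hγ : IsGeodesic γ T) (hV : IsParallel γ T V) :
    ‖element (γ 1) (V 1) - element (γ 0) (V 0)‖ ≤ ‖T 0‖ * ‖V 0‖ :=
  bOneNorm_le (IsDifferenceChain.order_one γ T V hγ hV).hasDecomposition

/-- The form in which the Harrison integral commutes with Bochner integrals; a continuous additive
map is real linear. -/
theorem exists_continuousLinearMap_eq_harrisonIntegral (θ : FormSpace n M) :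
    ∃ l : DifferentialChain n M →L[ℝ] ℝ, ∀ ξ, l ξ = harrisonIntegral ξ θ :=
  ⟨((FormSpace.toContinuousLinearMap θ : PointedChain n M →+ ℝ).extension
    (FormSpace.toContinuousLinearMap θ).continuous).toRealLinearMap
    (continuous_harrisonIntegral θ), fun _ => rfl⟩

variable [IsContMDiffRiemannianBundle (𝓡 n) ∞ (EuclideanSpace ℝ (Fin n))
  (fun x : M => TangentSpace (𝓡 n) x)]

/-- A section of the tangent bundle with continuous components is continuous as a map into the
space of pointed chains. -/
theorem continuous_element {X : ∀ p : M, TangentSpace (𝓡 n) p}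
    (hX : ∀ x₀, Filter.Tendsto (fun q => chartComponents x₀ q (X q)) (𝓝 x₀)
      (𝓝 (chartComponents x₀ x₀ (X x₀)))) :
    Continuous fun p => element p (X p) := by
  refine continuous_iff_continuousAt.2 fun x₀ => Metric.tendsto_nhds.2 fun ε hε => ?_
  have : IsContinuousRiemannianBundle (EuclideanSpace ℝ (Fin n))
      (fun x : M => TangentSpace (𝓡 n) x) := by
    obtain ⟨g, hg, hinner⟩ := IsContMDiffRiemannianBundle.exists_contMDiff (IB := 𝓡 n) (n := ∞)
      (F := EuclideanSpace ℝ (Fin n)) (E := fun x : M => TangentSpace (𝓡 n) x)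
    exact ⟨g, hg.continuous, hinner⟩
  obtain ⟨C, hC0, hC⟩ := eventually_norm_symmL_trivializationAt_lt (EuclideanSpace ℝ (Fin n))
    (fun x : M => TangentSpace (𝓡 n) x) x₀
  set A := ‖X x₀‖ with hA
  have hA0 : 0 ≤ A := norm_nonneg _
  -- The order one chain costs at most `η * A` and the vertical one `C * (2 * η)`; the extra `1`
  -- makes the inequality strict.
  set η := ε / (A + 2 * C + 1) with hη
  have hη0 : 0 < η := by positivity
  have hηε : η * (A + 2 * C + 1) = ε := div_mul_cancel₀ _ (by positivity)
  filter_upwards [eventually_exists_geodesic x₀ (X x₀) hη0, hC, chart_source_mem_nhds (EuclideanSpace ℝ (Fin n)) x₀,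
    Metric.tendsto_nhds.1 (hX x₀) η hη0] with q hq hCq hqs hXq
  obtain ⟨γ, T, V, hγ, hV, -, -, hT, hV0, hVA, a, hV1, ha⟩ := hq
  rw [dist_eq_norm] at hXq ⊢
  have h1 := norm_element_sub_element_le hγ hV
  rw [hV0, hV1, hVA] at h1
  have h2 : ‖element q (X q) - element q (ofChartComponents x₀ q a)‖ ≤
      C * ‖chartComponents x₀ q (X q) - a‖ := by
    rw [← element_sub]
    refine (norm_element_le _ _).trans ?_
    have h3 : X q - ofChartComponents x₀ q a =
        (trivializationAt (EuclideanSpace ℝ (Fin n)) (TangentSpace (𝓡 n)) x₀).symmL ℝ q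
          (chartComponents x₀ q (X q) - a) := by
      rw [map_sub]
      congr 1
      exact (ofChartComponents_chartComponents hqs (X q)).symm
    rw [h3]
    exact (ContinuousLinearMap.le_opNorm _ _).trans
      (mul_le_mul_of_nonneg_right hCq.le (norm_nonneg _))
  have h4 : ‖chartComponents x₀ q (X q) - a‖ ≤ 2 * η := by
    have h5 := norm_sub_le (chartComponents x₀ q (X q) - chartComponents x₀ x₀ (X x₀))
      (a - chartComponents x₀ x₀ (X x₀))
    rw [sub_sub_sub_cancel_right] at h5
    linarith
  have h6 := norm_add_le (element q (X q) - element q (ofChartComponents x₀ q a))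
    (element q (ofChartComponents x₀ q a) - element x₀ (X x₀))
  rw [sub_add_sub_cancel] at h6
  have h7 : ‖T 0‖ * A ≤ η * A := mul_le_mul_of_nonneg_right hT hA0
  have h8 : C * ‖chartComponents x₀ q (X q) - a‖ ≤ C * (2 * η) :=
    mul_le_mul_of_nonneg_left h4 hC0.le
  linarith

end Continuity

end DiffChain

end

/-! ### The chain as a Bochner integral. -/

theorem mainTheorem10 {n : ℕ} {M : Type*} [EMetricSpace M] [CompactSpace M]
    [ChartedSpace (EuclideanSpace ℝ (Fin n)) M] [IsManifold (𝓡 n) ∞ M]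
    [RiemannianBundle (fun x : M => TangentSpace (𝓡 n) x)]
    [IsContMDiffRiemannianBundle (𝓡 n) ∞ (EuclideanSpace ℝ (Fin n))
      (fun x : M => TangentSpace (𝓡 n) x)]
    [IsRiemannianManifold (𝓡 n) M]
    [MeasurableSpace M] [BorelSpace M]
    (X : ∀ p : M, TangentSpace (𝓡 n) p) (hX : DiffChain.IsLipschitzVectorField X)
    (μ : Measure M) [μ.Regular] :
    ∃ ξ : DiffChain.DifferentialChain n M, ∀ θ : DiffChain.FormSpace n M,
      Integrable (DiffChain.interiorProduct X θ) μ ∧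
      DiffChain.harrisonIntegral ξ θ = ∫ p, DiffChain.interiorProduct X θ p ∂μ := by
  have hcont : Continuous fun p => (DiffChain.element p (X p) : DiffChain.DifferentialChain n M) :=
    (UniformSpace.Completion.continuous_coe _).comp
      (DiffChain.continuous_element fun x₀ => hX.tendsto_chartComponents x₀)
  have hint := hcont.integrable_of_hasCompactSupport (μ := μ) (HasCompactSupport.of_compactSpace _)
  refine ⟨∫ p, (DiffChain.element p (X p) : DiffChain.DifferentialChain n M) ∂μ, fun θ => ?_⟩
  obtain ⟨l, hl⟩ := DiffChain.exists_continuousLinearMap_eq_harrisonIntegral θ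
  have hθ : ∀ p, l (DiffChain.element p (X p) : DiffChain.DifferentialChain n M) =
      DiffChain.interiorProduct X θ p := fun p => by
    rw [hl, DiffChain.harrisonIntegral_coe]
    rfl
  have h1 := l.integrable_comp hint
  have h2 := l.integral_comp_comm hint
  simp only [hθ] at h1 h2
  exact ⟨h1, by rw [← hl, ← h2]⟩
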